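/- Let $K$ be an algebraically closed field of arbitrary characteristic, $n\ge 1$, $K[[x]]=K[[x_1,\ldots,x_n]]$, $\mathfrak m=\langle x_1,\ldots,x_n\rangle$. **$C$-polytopes and valuations.** Let $W\subset\mathbb Q_{>0}^n$ be a finite nonempty set of weight vectors and put $\lambda_P(r)=\min_{w\in W} w\cdot r$ for $r\in\mathbb R^n$. Assume that $W$ is irredundant, i.e. no $w\in W$ can be omitted without changing the function $\lambda_P$. The set $W$ defines the $C$-polytope $P=\{r\in\mathbb R_{\ge 0}^n : \lambda_P(r)=1\}$. Let $N_P$ be the least common multiple of the denominators of all entries of the vectors in $W$. For $f=\sum_\alpha a_\alpha x^\alpha\in K[[x]]$ put $$v_P(f)=\min\{N_P\lambda_P(\alpha) : a_\alpha\neq 0\},\qquad v_P(0)=\infty,$$ and for a $K$-derivation $\xi=\sum_{i}\sum_{\alpha} a_{i,\alpha}x^\alpha\,\partial_{x_i}$ of $K[[x]]$ put $$v_P(\xi)=\min\{N_P\lambda_P(\alpha-e_i) : a_{i,\alpha}\neq 0\},\qquad v_P(0)=\infty,$$ where $e_i$ is the $i$-th standard basis vector. For $d\in\mathbb N$ let $F_d=\{f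 : v_P(f)\ge d\}$. The initial form $\mathrm{In}_P(f)$ is the sum of the terms $a_\alpha x^\alpha$ of $f$ with $a_\alpha\ne0$ for which $\lambda_P(\alpha)$ is minimal. **The condition AAC and regular bases.** For $h\in K[[x]]$ and $d\ge 0$ let $$\mathrm{tj}_P^{AC}(h)_d=\{g h+\xi h : g\in K[[x]],\ \xi\in\mathrm{Der}_K(K[[x]]),\ \min\{v_P(g)+v_P(h),\,v_P(\xi)+v_P(h)\}\ge d\}$$ and $$\mathrm{gr}_P^{AC}(T_h)=\bigoplus_{d\ge 0}F_d\big/\big(\mathrm{tj}_P^{AC}(h)_d+F_{d+1}\big).$$ The series $h$ satisfies AAC (with respect to $P$) if $\dim_K \mathrm{gr}_P^{AC}(T_h)<\infty$. A regular basis for $T_h$ is a set $B$ of monomials whose residue classes form a $K$-basis of $\mathrm{gr}_P^{AC}(T_h)$; here the residue class of $x^\alpha$ is taken in degree $v_P(x^\alpha)$. **Contact equivalence.** Write $f\sim_c g$ if $f=u\cdot\varphi(g)$ for some unit $u\in K[[x]]^*$ and some $K$-algebra automorphism $\varphi$ of $K[[x]]$. The series $f$ is contact $k$-determined if $f\sim_c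 g$ for every $g\in K[[x]]$ with $f-g\in\mathfrak m^{k+1}$. **Statement.** Let $P$ be a $C$-polytope, let $f\in\mathfrak m$ be such that $\mathrm{In}_P(f)$ satisfies AAC, and let $B$ be a regular basis for $T_{\mathrm{In}_P(f)}$. Then the maximum $$d=\max\big(\{v_P(\mathrm{In}_P(f))\}\cup\{v_P(x^\alpha) : x^\alpha\in B\}\big)$$ exists and is finite, and $f\sim_c g$ for every $g\in K[[x]]$ with $v_P(f-g)>d$. In particular, for every $k\in\mathbb N$ with $\mathfrak m^{k+1}\subseteq F_{d+1}$, the series $f$ is contact $k$-determined. -/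

import Mathlib

/-- A `C`-polytope in `ℝⁿ`, given by its finite nonempty irredundant set of weight vectors in
`ℚ_{>0}ⁿ`: each weight vector is, at some point, the only one at which the minimum of the
associated linear functions is attained, so none of them can be omitted from that minimum. -/
structure CPolytope (n : ℕ) where
  weights : Finset (Fin n → ℚ)
  nonempty : weights.Nonempty
  pos : ∀ w ∈ weights, ∀ j, 0 < w j
  irredundant : ∀ w ∈ weights, ∃ r : Fin n → ℝ, ∀ w' ∈ weights, w' ≠ w →
    ∑ j, (w j : ℝ) * r j < ∑ j, (w' j : ℝ) * r j

namespace CPolytope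

variable {n : ℕ}

/-- The concave piecewise linear function `λ_P = min_i λ_i` on `ℝⁿ`. -/
noncomputable def lam (P : CPolytope n) (r : Fin n → ℝ) : ℝ :=
  P.weights.inf' P.nonempty fun w => ∑ j, (w j : ℝ) * r j

/-- The polytope itself: the level set `λ_P = 1` in the closed positive orthant. -/
def carrier (P : CPolytope n) : Set (Fin n → ℝ) :=
  {r | (∀ j, 0 ≤ r j) ∧ P.lam r = 1}

/-- `N_P`: the least common multiple of the denominators of all entries of the weight vectors. -/
def denom (P : CPolytope n) : ℕ :=
  P.weights.lcm fun w => Finset.univ.lcm fun j => (w j).den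

theorem denom_pos (P : CPolytope n) : 0 < P.denom := by
  refine Nat.pos_of_ne_zero fun h => ?_
  simp only [denom, Finset.lcm_eq_zero_iff] at h
  obtain ⟨w, -, hw⟩ := h
  obtain ⟨j, -, hj⟩ := hw
  exact (w j).den_nz hj

/-- The integer `N_P · λ_P(β)` for `β ∈ ℤⁿ`; the floor only changes the type,
see `vdeg_cast`. -/
noncomputable def vdeg (P : CPolytope n) (β : Fin n → ℤ) : ℤ :=
  ⌊(P.denom : ℝ) * P.lam fun j => (β j : ℝ)⌋

theorem vdeg_cast (P : CPolytope n) (β : Fin n → ℤ) :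
    (P.vdeg β : ℝ) = (P.denom : ℝ) * P.lam fun j => (β j : ℝ) := by
  suffices h : ∃ m : ℤ, (P.denom : ℝ) * P.lam (fun j => (β j : ℝ)) = m by
    obtain ⟨m, hm⟩ := h
    rw [vdeg, hm, Int.floor_intCast]
  obtain ⟨w, hw, h⟩ := Finset.exists_mem_eq_inf' P.nonempty
    fun w : Fin n → ℚ => ∑ j, (w j : ℝ) * (β j : ℝ)
  have key : ∀ j, ∃ c : ℤ, (P.denom : ℝ) * (w j : ℝ) = c := fun j => by
    have h1 : (w j).den ∣ P.denom :=
      (Finset.dvd_lcm (f := fun j => (w j).den) (Finset.mem_univ j)).trans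
        (Finset.dvd_lcm (f := fun w : Fin n → ℚ => Finset.univ.lcm fun j => (w j).den) hw)
    obtain ⟨c, hc⟩ := h1
    refine ⟨c * (w j).num, ?_⟩
    have h2 : (w j) * ((w j).den : ℚ) = (w j).num := Rat.mul_den_eq_num _
    have h3 : (w j : ℝ) * ((w j).den : ℝ) = (w j).num := by exact_mod_cast h2
    rw [hc]
    push_cast
    rw [← h3]
    ring
  choose c hc using key
  refine ⟨∑ j, c j * β j, ?_⟩
  rw [lam, h, Finset.mul_sum]
  push_cast
  exact Finset.sum_congr rfl fun j _ => by rw [← hc]; ring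

theorem lam_add_le (P : CPolytope n) (r s : Fin n → ℝ) :
    P.lam r + P.lam s ≤ P.lam (r + s) := by
  refine Finset.le_inf' _ _ fun w hw => ?_
  have h1 : P.lam r ≤ ∑ j, (w j : ℝ) * r j := Finset.inf'_le _ hw
  have h2 : P.lam s ≤ ∑ j, (w j : ℝ) * s j := Finset.inf'_le _ hw
  simp only [Pi.add_apply, mul_add, Finset.sum_add_distrib]
  exact add_le_add h1 h2

theorem vdeg_add_le (P : CPolytope n) (β γ : Fin n → ℤ) :
    P.vdeg β + P.vdeg γ ≤ P.vdeg (β + γ) := by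
  have h := mul_le_mul_of_nonneg_left
    (P.lam_add_le (fun j => (β j : ℝ)) fun j => (γ j : ℝ)) (Nat.cast_nonneg (α := ℝ) P.denom)
  have e : (fun j => (β j : ℝ)) + (fun j => (γ j : ℝ)) = fun j => ((β + γ) j : ℝ) := by
    funext j; simp
  rw [e, mul_add, ← vdeg_cast, ← vdeg_cast, ← vdeg_cast] at h
  exact_mod_cast h

theorem vdeg_nonneg (P : CPolytope n) (β : Fin n → ℤ) (hβ : ∀ j, 0 ≤ β j) : 0 ≤ P.vdeg β := by
  refine Int.floor_nonneg.2 (mul_nonneg (Nat.cast_nonneg _) (Finset.le_inf' _ _ fun w hw => ?_))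
  refine Finset.sum_nonneg fun j _ => mul_nonneg ?_ ?_
  · exact_mod_cast (P.pos w hw j).le
  · exact Int.cast_nonneg (hβ j)

/-- `N_P · λ_P(α)` for an exponent `α ∈ ℕⁿ`. -/
noncomputable def mdeg (P : CPolytope n) (α : Fin n →₀ ℕ) : ℤ :=
  P.vdeg fun j => (α j : ℤ)

/-- `N_P · λ_P(α - e_i)`, the degree of `x^α ∂_{x_i}`. -/
noncomputable def ddeg (P : CPolytope n) (i : Fin n) (α : Fin n →₀ ℕ) : ℤ :=
  P.vdeg fun j => (α j : ℤ) - (Pi.single i (1 : ℤ) : Fin n → ℤ) j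

theorem mdeg_nonneg (P : CPolytope n) (α : Fin n →₀ ℕ) : 0 ≤ P.mdeg α :=
  P.vdeg_nonneg _ fun _ => Int.natCast_nonneg _

theorem mdeg_add_le (P : CPolytope n) (α β : Fin n →₀ ℕ) :
    P.mdeg α + P.mdeg β ≤ P.mdeg (α + β) := by
  refine (P.vdeg_add_le _ _).trans (le_of_eq ?_)
  rw [mdeg]; congr 1

theorem mdeg_add_ddeg_le (P : CPolytope n) (i : Fin n) (α β : Fin n →₀ ℕ) :
    P.mdeg α + P.ddeg i β ≤ P.ddeg i (α + β) := by
  refine (P.vdeg_add_le _ _).trans (le_of_eq ?_)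
  rw [ddeg]; congr 1; funext j; simp; ring

/-- The minimum of a set of integers that is bounded below, `⊤` for the empty set. -/
noncomputable def minOrTop (S : Set ℤ) : WithTop ℤ :=
  open Classical in if S.Nonempty then ((sInf S : ℤ) : WithTop ℤ) else ⊤

theorem le_minOrTop_iff {S : Set ℤ} (hS : BddBelow S) (m : ℤ) :
    (m : WithTop ℤ) ≤ minOrTop S ↔ ∀ s ∈ S, m ≤ s := by
  unfold minOrTop
  split_ifs with h
  · rw [WithTop.coe_le_coe]
    exact le_csInf_iff hS h
  · simp only [le_top, true_iff]
    exact fun s hs => (h ⟨s, hs⟩).elim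

theorem isLeast_minOrTop {S : Set ℤ} (hS : BddBelow S) (h : S.Nonempty) :
    ∃ m : ℤ, minOrTop S = m ∧ IsLeast S m :=
  ⟨sInf S, if_pos h, Int.csInf_mem h hS, fun _ hs => csInf_le hS hs⟩

variable {K : Type*} [Field K]

/-- The piecewise valuation `v_P(f) = min {N_P · λ_P(α) | a_α ≠ 0}`, with `v_P(0) = ∞`. -/
noncomputable def val (P : CPolytope n) (f : MvPowerSeries (Fin n) K) : WithTop ℤ :=
  minOrTop {m | ∃ α, MvPowerSeries.coeff α f ≠ 0 ∧ P.mdeg α = m}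

/-- The valuation `v_P(ξ) = min {N_P · λ_P(α - e_i) | a_{i,α} ≠ 0}` of a derivation
`ξ = ∑_i ∑_α a_{i,α} x^α ∂_{x_i}`; here `∑_α a_{i,α} x^α = ξ(x_i)`. -/
noncomputable def derVal (P : CPolytope n)
    (ξ : Derivation K (MvPowerSeries (Fin n) K) (MvPowerSeries (Fin n) K)) : WithTop ℤ :=
  minOrTop {m | ∃ i α, MvPowerSeries.coeff α (ξ (MvPowerSeries.X i)) ≠ 0 ∧ P.ddeg i α = m}

theorem le_val_iff (P : CPolytope n) (f : MvPowerSeries (Fin n) K) (m : ℤ) :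
    (m : WithTop ℤ) ≤ P.val f ↔ ∀ α, MvPowerSeries.coeff α f ≠ 0 → m ≤ P.mdeg α := by
  rw [val, le_minOrTop_iff ⟨0, ?_⟩]
  · exact ⟨fun h α hα => h _ ⟨α, hα, rfl⟩, by rintro h _ ⟨α, hα, rfl⟩; exact h α hα⟩
  · rintro _ ⟨α, -, rfl⟩
    exact P.mdeg_nonneg α

theorem ddeg_bddBelow (P : CPolytope n) : ∃ b : ℤ, ∀ i α, b ≤ P.ddeg i α := by
  obtain ⟨b, hb⟩ := (Set.finite_range fun i => P.ddeg i 0).bddBelow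
  refine ⟨b, fun i α => (hb ⟨i, rfl⟩).trans ?_⟩
  have h := P.mdeg_add_ddeg_le i α 0
  rw [add_zero] at h
  have := P.mdeg_nonneg α
  change P.ddeg i 0 ≤ _
  omega

theorem le_derVal_iff (P : CPolytope n)
    (ξ : Derivation K (MvPowerSeries (Fin n) K) (MvPowerSeries (Fin n) K)) (m : ℤ) :
    (m : WithTop ℤ) ≤ P.derVal ξ ↔
      ∀ i α, MvPowerSeries.coeff α (ξ (MvPowerSeries.X i)) ≠ 0 → m ≤ P.ddeg i α := by
  obtain ⟨b, hb⟩ := P.ddeg_bddBelow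
  rw [derVal, le_minOrTop_iff ⟨b, ?_⟩]
  · exact ⟨fun h i α hα => h _ ⟨i, α, hα, rfl⟩,
      by rintro h _ ⟨i, α, hα, rfl⟩; exact h i α hα⟩
  · rintro _ ⟨i, α, -, rfl⟩
    exact hb i α

theorem le_of_forall_int_le {a b : WithTop ℤ} (h : ∀ m : ℤ, (m : WithTop ℤ) ≤ a → m ≤ b) :
    a ≤ b := by
  induction a with
  | coe a => exact h a le_rfl
  | top =>
    induction b with
    | top => exact le_rfl
    | coe b =>
      have := h (b + 1) le_top
      rw [WithTop.coe_le_coe] at this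
      omega

theorem min_val_le_add (P : CPolytope n) (f g : MvPowerSeries (Fin n) K) :
    min (P.val f) (P.val g) ≤ P.val (f + g) := by
  refine le_of_forall_int_le fun m hm => ?_
  rw [le_min_iff, le_val_iff, le_val_iff] at hm
  rw [le_val_iff]
  intro α hα
  by_cases h : MvPowerSeries.coeff α f = 0
  · exact hm.2 α fun h' => hα (by rw [map_add, h, h', add_zero])
  · exact hm.1 α h

theorem val_le_mul (P : CPolytope n) (h f : MvPowerSeries (Fin n) K) :
    P.val f ≤ P.val (h * f) := by
  classical
  refine le_of_forall_int_le fun m hm => ?_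
  rw [le_val_iff] at hm ⊢
  intro α hα
  rw [MvPowerSeries.coeff_mul] at hα
  obtain ⟨p, hp, hne⟩ := Finset.exists_ne_zero_of_sum_ne_zero hα
  have h1 := hm p.2 (right_ne_zero_of_mul hne)
  have h2 := P.mdeg_add_le p.1 p.2
  have h3 := P.mdeg_nonneg p.1
  rw [Finset.HasAntidiagonal.mem_antidiagonal.1 hp] at h2
  omega

theorem min_derVal_le_add (P : CPolytope n)
    (ξ η : Derivation K (MvPowerSeries (Fin n) K) (MvPowerSeries (Fin n) K)) :
    min (P.derVal ξ) (P.derVal η) ≤ P.derVal (ξ + η) := by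
  refine le_of_forall_int_le fun m hm => ?_
  rw [le_min_iff, le_derVal_iff, le_derVal_iff] at hm
  rw [le_derVal_iff]
  intro i α hα
  by_cases h : MvPowerSeries.coeff α (ξ (MvPowerSeries.X i)) = 0
  · exact hm.2 i α fun h' => hα (by rw [Derivation.add_apply, map_add, h, h', add_zero])
  · exact hm.1 i α h

theorem derVal_le_smul (P : CPolytope n) (h : MvPowerSeries (Fin n) K)
    (ξ : Derivation K (MvPowerSeries (Fin n) K) (MvPowerSeries (Fin n) K)) :
    P.derVal ξ ≤ P.derVal (h • ξ) := by
  classical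
  refine le_of_forall_int_le fun m hm => ?_
  rw [le_derVal_iff] at hm ⊢
  intro i α hα
  rw [Derivation.smul_apply, smul_eq_mul, MvPowerSeries.coeff_mul] at hα
  obtain ⟨p, hp, hne⟩ := Finset.exists_ne_zero_of_sum_ne_zero hα
  have h1 := hm i p.2 (right_ne_zero_of_mul hne)
  have h2 := P.mdeg_add_ddeg_le i p.1 p.2
  have h3 := P.mdeg_nonneg p.1
  rw [Finset.HasAntidiagonal.mem_antidiagonal.1 hp] at h2
  omega

/-- The ideal `F_d = {f | v_P(f) ≥ d}`. -/
noncomputable def filt (P : CPolytope n) (d : ℕ) :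
    Ideal (MvPowerSeries (Fin n) K) where
  carrier := {f | ((d : ℤ) : WithTop ℤ) ≤ P.val f}
  zero_mem' := (le_val_iff P 0 d).2 fun _ h => (h (map_zero _)).elim
  add_mem' {f g} hf hg := (le_min hf hg).trans (P.min_val_le_add f g)
  smul_mem' h f hf := le_trans hf (P.val_le_mul h f)

/-- The initial form `In_P(f)`: the sum of the terms of `f` of minimal piecewise degree. -/
noncomputable def initialForm (P : CPolytope n) (f : MvPowerSeries (Fin n) K) :
    MvPowerSeries (Fin n) K :=
  open Classical in fun α =>
    if ∀ β, MvPowerSeries.coeff β f ≠ 0 → P.mdeg α ≤ P.mdeg β then MvPowerSeries.coeff α f else 0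

/-- The ideal `tj_P^{AC}(f)_d = {g f + ξ f | min {v_P(g) + v_P(f), v_P(ξ) + v_P(f)} ≥ d}`. -/
noncomputable def tjAC (P : CPolytope n) (f : MvPowerSeries (Fin n) K) (d : ℕ) :
    Ideal (MvPowerSeries (Fin n) K) where
  carrier := {h | ∃ (g : MvPowerSeries (Fin n) K)
    (ξ : Derivation K (MvPowerSeries (Fin n) K) (MvPowerSeries (Fin n) K)),
      h = g * f + ξ f ∧
      ((d : ℤ) : WithTop ℤ) ≤ min (P.val g + P.val f) (P.derVal ξ + P.val f)}
  zero_mem' := by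
    refine ⟨0, 0, by simp, ?_⟩
    have h1 : P.val (0 : MvPowerSeries (Fin n) K) = ⊤ :=
      top_le_iff.1 (le_of_forall_int_le fun m _ => by simp [le_val_iff])
    have h2 : P.derVal (0 : Derivation K (MvPowerSeries (Fin n) K)
        (MvPowerSeries (Fin n) K)) = ⊤ :=
      top_le_iff.1 (le_of_forall_int_le fun m _ => by simp [le_derVal_iff])
    simp [h1, h2]
  add_mem' := by
    rintro _ _ ⟨g, ξ, rfl, h⟩ ⟨g', ξ', rfl, h'⟩
    rw [le_min_iff] at h h'
    refine ⟨g + g', ξ + ξ', by rw [Derivation.add_apply]; ring, le_min ?_ ?_⟩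
    · refine le_trans ?_ (add_le_add_left (P.min_val_le_add g g') _)
      rcases min_choice (P.val g) (P.val g') with e | e <;> rw [e]
      exacts [h.1, h'.1]
    · refine le_trans ?_ (add_le_add_left (P.min_derVal_le_add ξ ξ') _)
      rcases min_choice (P.derVal ξ) (P.derVal ξ') with e | e <;> rw [e]
      exacts [h.2, h'.2]
  smul_mem' := by
    rintro a _ ⟨g, ξ, rfl, h⟩
    rw [le_min_iff] at h
    refine ⟨a * g, a • ξ, ?_, le_min ?_ ?_⟩
    · simp only [smul_eq_mul, Derivation.smul_apply]; ring
    · exact h.1.trans (add_le_add_left (P.val_le_mul a g) _)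
    · exact h.2.trans (add_le_add_left (P.derVal_le_smul a ξ) _)

/-- The degree `d` part `F_d / (tj_P^{AC}(f)_d + F_{d+1})` of `gr_P^{AC}(T_f)`. -/
abbrev GrACPiece (P : CPolytope n) (f : MvPowerSeries (Fin n) K) (d : ℕ) : Type _ :=
  (filt P d : Ideal (MvPowerSeries (Fin n) K)) ⧸
    Submodule.comap (Submodule.subtype (filt P d)) (tjAC P f d ⊔ filt P (d + 1))

/-- The graded `K`-vector space
`gr_P^{AC}(T_f) = ⨁_{d ≥ 0} F_d / (tj_P^{AC}(f)_d + F_{d+1})`. -/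
abbrev GrAC (P : CPolytope n) (f : MvPowerSeries (Fin n) K) : Type _ :=
  DirectSum ℕ fun d => GrACPiece P f d

/-- Condition AAC with respect to `P`: `gr_P^{AC}(T_f)` is finite dimensional. -/
def AAC (P : CPolytope n) (f : MvPowerSeries (Fin n) K) : Prop :=
  Module.Finite K (GrAC P f)

theorem monomial_mem_filt (P : CPolytope n) (α : Fin n →₀ ℕ) :
    MvPowerSeries.monomial α (1 : K) ∈ filt P (P.mdeg α).toNat := by
  classical
  change (((P.mdeg α).toNat : ℤ) : WithTop ℤ) ≤ P.val _
  rw [Int.toNat_of_nonneg (P.mdeg_nonneg α), le_val_iff]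
  intro β hβ
  rw [MvPowerSeries.coeff_monomial] at hβ
  by_cases h : β = α
  · rw [h]
  · simp [h] at hβ

/-- The residue class of the monomial `x^α` in `gr_P^{AC}(T_f)`; it lives in degree
`v_P(x^α) = N_P · λ_P(α)`. -/
noncomputable def monomialClass (P : CPolytope n) (f : MvPowerSeries (Fin n) K)
    (α : Fin n →₀ ℕ) : GrAC P f :=
  DirectSum.of
    (fun d => GrACPiece P f d)
    (P.mdeg α).toNat
    (Submodule.Quotient.mk ⟨MvPowerSeries.monomial α (1 : K), P.monomial_mem_filt α⟩)

/-- `B = {x^α | α ∈ Λ}` is a regular basis for `T_f`: the residue classes of the monomials in `B`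
form a `K`-basis of `gr_P^{AC}(T_f)`. -/
def IsRegularBasis (P : CPolytope n) (f : MvPowerSeries (Fin n) K) (Λ : Set (Fin n →₀ ℕ)) :
    Prop :=
  LinearIndependent K (fun α : Λ => P.monomialClass f (α : Fin n →₀ ℕ)) ∧
    Submodule.span K (Set.range fun α : Λ => P.monomialClass f (α : Fin n →₀ ℕ)) = ⊤

end CPolytope

/-- The ideal `𝔪 = ⟨x_1, …, x_n⟩` of `K[[x_1, …, x_n]]`. -/
noncomputable def powerSeriesMaxIdeal (n : ℕ) (K : Type*) [Field K] :
    Ideal (MvPowerSeries (Fin n) K) :=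
  Ideal.span (Set.range MvPowerSeries.X)

/-- `f ∼_c g`: `f = u · φ(g)` for a unit `u` and a `K`-algebra automorphism `φ`. -/
def ContactEquivalent {n : ℕ} {K : Type*} [Field K] (f g : MvPowerSeries (Fin n) K) : Prop :=
  ∃ (u : (MvPowerSeries (Fin n) K)ˣ)
    (φ : MvPowerSeries (Fin n) K ≃ₐ[K] MvPowerSeries (Fin n) K), f = u * φ g

/-- `f` is contact `k`-determined: `f ∼_c g` for every `g` that coincides with `f` up to
order `k`. -/
def ContactDetermined {n : ℕ} {K : Type*} [Field K] (k : ℕ) (f : MvPowerSeries (Fin n) K) :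
    Prop :=
  ∀ g : MvPowerSeries (Fin n) K, f - g ∈ powerSeriesMaxIdeal n K ^ (k + 1) →
    ContactEquivalent f g

/-! Let `h` be the initial form of `f`, of degree `D`. Above the degree `d` there are no basis
monomials, so the graded pieces vanish there: every `r` of degree `m > d` is `b * h + η h` up to
degree `m + 1`, with `b` and `η` of degree at least `m - D`. The equation `f = (1 + a) * φ(g)` is
then solved by successive approximation. If `r` is the current error, replace `a` by `a + b` and
`φ(x_i)` by `φ(x_i) + η(x_i)`; the new error has degree at least `m + 1`. As `d ≥ D`, the
corrections have positive degree, so `1 + a` stays a unit and `φ` stays close to the identity. The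
corrections converge since `K[[x]]` is complete. Only first order Taylor expansion is used, no
exponentials of derivations, so the characteristic plays no role.

The difficulty is that `v_P` is only superadditive on products: the bounds on `v_P(φ(x_i))` do not
add up to `v_P(x^α)`. The degree of a term `x^β` of `φ(x^α)` is therefore measured by `N_P λ_P(β -
α)`, relative to the exponent `α`. These relative filtrations (`relFilt`) multiply
(`mul_mem_relFilt`), and superadditivity brings the estimates back to `v_P` at the end
(`mem_relFilt_zero_of_mem`).

The main steps are `algHom_sub_sub_derivation_monomial_mem` (Taylor), `IsNearId.bijective_hom`
(inverse function theorem), `exists_improved_approximation` (one correction),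
`contactEquivalent_of_forall_approx` (the limit) and `IsRegularBasis.filt_le` (vanishing of graded
pieces). -/

namespace CPolytope

open MvPowerSeries

variable {n : ℕ} {K : Type*} [Field K]

/-! ### Degrees relative to an exponent, and completeness -/

/-- The exponent `α ∈ ℕⁿ` as a vector of integers. -/
def intExp (α : Fin n →₀ ℕ) : Fin n → ℤ := fun j => (α j : ℤ)

theorem intExp_zero : intExp (0 : Fin n →₀ ℕ) = 0 := by
  funext j; simp [intExp]

theorem intExp_add (α β : Fin n →₀ ℕ) : intExp (α + β) = intExp α + intExp β := by
  funext j; simp [intExp]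

theorem intExp_single (i : Fin n) : intExp (Finsupp.single i 1) = Pi.single i 1 := by
  classical
  funext j
  simp [intExp, Finsupp.single_apply, Pi.single_apply, eq_comm]

theorem vdeg_zero (P : CPolytope n) : P.vdeg 0 = 0 := by
  have h : (P.vdeg 0 : ℝ) = 0 := by
    rw [vdeg_cast]
    simp [lam]
  exact_mod_cast h

theorem vdeg_single_pos (P : CPolytope n) (i : Fin n) : 0 < P.vdeg (Pi.single i 1) := by
  have h : (0 : ℝ) < P.vdeg (Pi.single i 1) := by
    rw [vdeg_cast]
    refine mul_pos (by exact_mod_cast P.denom_pos) ?_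
    rw [lam, Finset.lt_inf'_iff]
    intro w hw
    have e : ∀ j, (w j : ℝ) * (((Pi.single i 1 : Fin n → ℤ) j : ℤ) : ℝ) =
        if j = i then (w i : ℝ) else 0 := by
      intro j
      by_cases h : j = i
      · subst h; simp
      · simp [h]
    simp only [e, Finset.sum_ite_eq', Finset.mem_univ, if_true]
    exact_mod_cast P.pos w hw i
  exact_mod_cast h

/-- The power series all of whose terms have piecewise degree at least `m` relative to `γ`. -/
def relFilt (P : CPolytope n) (K : Type*) [Field K] (γ : Fin n → ℤ) (m : ℤ) :
    Submodule K (MvPowerSeries (Fin n) K) where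
  carrier := {y | ∀ β, coeff β y ≠ 0 → m ≤ P.vdeg (intExp β - γ)}
  zero_mem' := fun _ h => (h (map_zero _)).elim
  add_mem' {x y} hx hy := by
    intro β hβ
    by_cases h : coeff β x = 0
    · exact hy β fun h' => hβ (by rw [map_add, h, h', add_zero])
    · exact hx β h
  smul_mem' a x hx := by
    intro β hβ
    refine hx β fun h => hβ ?_
    rw [coeff_smul, h, mul_zero]

theorem mem_relFilt {P : CPolytope n} {γ : Fin n → ℤ} {m : ℤ} {y : MvPowerSeries (Fin n) K} :
    y ∈ P.relFilt K γ m ↔ ∀ β, coeff β y ≠ 0 → m ≤ P.vdeg (intExp β - γ) := Iff.rfl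

theorem mem_relFilt_zero {P : CPolytope n} {m : ℤ} {y : MvPowerSeries (Fin n) K} :
    y ∈ P.relFilt K 0 m ↔ ∀ β, coeff β y ≠ 0 → m ≤ P.mdeg β := by
  simp only [mem_relFilt, sub_zero]; rfl

theorem mem_relFilt_zero_iff_val {P : CPolytope n} {m : ℤ} {y : MvPowerSeries (Fin n) K} :
    y ∈ P.relFilt K 0 m ↔ (m : WithTop ℤ) ≤ P.val y := by
  rw [mem_relFilt_zero, le_val_iff]

theorem le_derVal_iff_mem_relFilt {P : CPolytope n} {m : ℤ}
    {ξ : Derivation K (MvPowerSeries (Fin n) K) (MvPowerSeries (Fin n) K)} :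
    (m : WithTop ℤ) ≤ P.derVal ξ ↔ ∀ i, ξ (X i) ∈ P.relFilt K (Pi.single i 1) m :=
  le_derVal_iff P ξ m

theorem relFilt_anti {P : CPolytope n} {γ : Fin n → ℤ} {m k : ℤ} (h : k ≤ m)
    {y : MvPowerSeries (Fin n) K} (hy : y ∈ P.relFilt K γ m) : y ∈ P.relFilt K γ k :=
  fun β hβ => h.trans (hy β hβ)

theorem mul_mem_relFilt {P : CPolytope n} {γ δ : Fin n → ℤ} {m k : ℤ}
    {x y : MvPowerSeries (Fin n) K} (hx : x ∈ P.relFilt K γ m) (hy : y ∈ P.relFilt K δ k) :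
    x * y ∈ P.relFilt K (γ + δ) (m + k) := by
  classical
  intro β hβ
  rw [coeff_mul] at hβ
  obtain ⟨p, hp, hne⟩ := Finset.exists_ne_zero_of_sum_ne_zero hβ
  have h1 := hx p.1 (left_ne_zero_of_mul hne)
  have h2 := hy p.2 (right_ne_zero_of_mul hne)
  have h3 := P.vdeg_add_le (intExp p.1 - γ) (intExp p.2 - δ)
  have e : intExp p.1 - γ + (intExp p.2 - δ) = intExp β - (γ + δ) := by
    rw [← Finset.HasAntidiagonal.mem_antidiagonal.1 hp, intExp_add]; abel
  rw [e] at h3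
  omega

theorem mul_mem_relFilt_of_le {P : CPolytope n} {γ δ : Fin n → ℤ} {m k l : ℤ}
    {x y : MvPowerSeries (Fin n) K} (hx : x ∈ P.relFilt K γ m) (hy : y ∈ P.relFilt K δ k)
    (h : l ≤ m + k) : x * y ∈ P.relFilt K (γ + δ) l :=
  relFilt_anti h (mul_mem_relFilt hx hy)

theorem mul_mem_relFilt_zero {P : CPolytope n} {m k l : ℤ}
    {x y : MvPowerSeries (Fin n) K} (hx : x ∈ P.relFilt K 0 m) (hy : y ∈ P.relFilt K 0 k)
    (h : l ≤ m + k) : x * y ∈ P.relFilt K 0 l := by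
  have := mul_mem_relFilt_of_le hx hy h
  rwa [add_zero] at this

theorem one_mem_relFilt (P : CPolytope n) : (1 : MvPowerSeries (Fin n) K) ∈ P.relFilt K 0 0 :=
  mem_relFilt_zero.2 fun β _ => P.mdeg_nonneg β

theorem mem_relFilt_zero_of_nonpos (P : CPolytope n) (y : MvPowerSeries (Fin n) K) {m : ℤ}
    (hm : m ≤ 0) : y ∈ P.relFilt K 0 m :=
  mem_relFilt_zero.2 fun β _ => hm.trans (P.mdeg_nonneg β)

theorem X_mem_relFilt (P : CPolytope n) (i : Fin n) :
    (X i : MvPowerSeries (Fin n) K) ∈ P.relFilt K (Pi.single i 1) 0 := by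
  classical
  intro β hβ
  rw [coeff_X] at hβ
  have : β = Finsupp.single i 1 := by
    by_contra h
    simp [h] at hβ
  rw [this, intExp_single, sub_self, vdeg_zero]

/-- Superadditivity applied to `β = γ + (β - γ)`; this turns relative estimates into estimates for
`v_P`. -/
theorem mem_relFilt_zero_of_mem {P : CPolytope n} {γ : Fin n → ℤ} {m : ℤ}
    {y : MvPowerSeries (Fin n) K} (hy : y ∈ P.relFilt K γ m) :
    y ∈ P.relFilt K 0 (P.vdeg γ + m) := by
  intro β hβ
  have h1 := hy β hβ
  have h2 := P.vdeg_add_le γ (intExp β - γ)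
  rw [add_sub_cancel] at h2
  rw [sub_zero]
  omega

theorem eq_zero_of_forall_mem_relFilt {P : CPolytope n} {γ : Fin n → ℤ}
    {y : MvPowerSeries (Fin n) K} (h : ∀ k : ℕ, y ∈ P.relFilt K γ k) : y = 0 := by
  ext β
  rw [map_zero]
  by_contra hβ
  have := h ((P.vdeg (intExp β - γ)).toNat + 1) β hβ
  omega

/-- Completeness of `K[[x]]` for the filtration relative to `γ`. -/
theorem exists_limit_relFilt (P : CPolytope n) (γ : Fin n → ℤ)
    (y : ℕ → MvPowerSeries (Fin n) K) (hy : ∀ k : ℕ, y (k + 1) - y k ∈ P.relFilt K γ k) :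
    ∃ z : MvPowerSeries (Fin n) K, ∀ k : ℕ, z - y k ∈ P.relFilt K γ k := by
  have cauchy : ∀ k l : ℕ, k ≤ l → y l - y k ∈ P.relFilt K γ k := by
    intro k l hkl
    induction l, hkl using Nat.le_induction with
    | base => rw [sub_self]; exact zero_mem _
    | succ l hl ih =>
      have := add_mem (relFilt_anti (by exact_mod_cast hl) (hy l)) ih
      rwa [sub_add_sub_cancel] at this
  -- From index `N β` on, the coefficient of `x^β` is constant: later differences have relative
  -- degree exceeding that of `x^β`.
  let N : (Fin n →₀ ℕ) → ℕ := fun β => (P.vdeg (intExp β - γ)).toNat + 1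
  let z : MvPowerSeries (Fin n) K := fun β => coeff β (y (N β))
  have hz : ∀ β, coeff β z = coeff β (y (N β)) := fun β => rfl
  refine ⟨z, fun k β hβ => ?_⟩
  rw [map_sub, hz, ← map_sub] at hβ
  rcases le_total k (N β) with h | h
  · exact cauchy k _ h β hβ
  · have h1 : coeff β (y k - y (N β)) ≠ 0 := by
      rw [← neg_sub, map_neg]
      exact neg_ne_zero.2 hβ
    have h2 := cauchy _ k h β h1
    simp only [N] at h2
    omega

/-! ### Endomorphisms and derivations on monomials -/

/-- Exponent and series are separate arguments of `p`, so that a relative degree can be carried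
along products, starting from the variables. -/
theorem monomial_induction {p : (Fin n → ℤ) → MvPowerSeries (Fin n) K → Prop}
    (one : p 0 1) (mul : ∀ γ δ x y, p γ x → p δ y → p (γ + δ) (x * y))
    (X : ∀ i, p (Pi.single i 1) (X i)) (α : Fin n →₀ ℕ) :
    p (intExp α) (monomial α 1) := by
  induction α using Finsupp.induction_linear with
  | zero => rw [intExp_zero]; exact one
  | add α β hα hβ =>
    have := mul _ _ _ _ hα hβ
    rwa [monomial_mul_monomial, one_mul, ← intExp_add] at this
  | single i k =>
    induction k with
    | zero => rw [Finsupp.single_zero, intExp_zero]; exact one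
    | succ k ih =>
      have h := mul _ _ _ _ ih (X i)
      rwa [← intExp_single, MvPowerSeries.X, monomial_mul_monomial, one_mul, ← intExp_add,
        ← Finsupp.single_add] at h

theorem algHom_sub_monomial_mem {P : CPolytope n}
    {φ ψ : MvPowerSeries (Fin n) K →ₐ[K] MvPowerSeries (Fin n) K} {c : ℤ}
    (hφ : ∀ i, φ (X i) ∈ P.relFilt K (Pi.single i 1) 0)
    (hψ : ∀ i, ψ (X i) ∈ P.relFilt K (Pi.single i 1) 0)
    (h : ∀ i, φ (X i) - ψ (X i) ∈ P.relFilt K (Pi.single i 1) c) (α : Fin n →₀ ℕ) :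
    φ (monomial α 1) - ψ (monomial α 1) ∈ P.relFilt K (intExp α) c := by
  refine (monomial_induction (p := fun γ x => φ x ∈ P.relFilt K γ 0 ∧ ψ x ∈ P.relFilt K γ 0 ∧
    φ x - ψ x ∈ P.relFilt K γ c) ?_ ?_ (fun i => ⟨hφ i, hψ i, h i⟩) α).2.2
  · simp only [map_one, sub_self]
    exact ⟨one_mem_relFilt P, one_mem_relFilt P, zero_mem _⟩
  · rintro γ δ x y ⟨h1, h2, h3⟩ ⟨k1, k2, k3⟩
    simp only [map_mul]
    refine ⟨mul_mem_relFilt_of_le h1 k1 (by simp), mul_mem_relFilt_of_le h2 k2 (by simp), ?_⟩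
    have e : φ x * φ y - ψ x * ψ y = (φ x - ψ x) * φ y + ψ x * (φ y - ψ y) := by ring
    rw [e]
    exact add_mem (mul_mem_relFilt_of_le h3 k1 (by simp)) (mul_mem_relFilt_of_le h2 k3 (by simp))

/-- First order Taylor expansion: if `φ(x_i) - ψ(x_i) = η(x_i)` has relative degree at least `c`,
then `φ - ψ` and `η` agree on monomials up to terms of relative degree at least `c + 1`. -/
theorem algHom_sub_sub_derivation_monomial_mem {P : CPolytope n}
    {φ ψ : MvPowerSeries (Fin n) K →ₐ[K] MvPowerSeries (Fin n) K} {c : ℤ}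
    {η : Derivation K (MvPowerSeries (Fin n) K) (MvPowerSeries (Fin n) K)}
    (hφ : ∀ i, φ (X i) - X i ∈ P.relFilt K (Pi.single i 1) 1)
    (hψ : ∀ i, ψ (X i) - X i ∈ P.relFilt K (Pi.single i 1) 1)
    (hη : ∀ i, η (X i) ∈ P.relFilt K (Pi.single i 1) c)
    (h : ∀ i, φ (X i) - ψ (X i) = η (X i)) (α : Fin n →₀ ℕ) :
    φ (monomial α 1) - ψ (monomial α 1) - η (monomial α 1) ∈ P.relFilt K (intExp α) (c + 1) := by
  refine (monomial_induction (p := fun γ x => x ∈ P.relFilt K γ 0 ∧ φ x - x ∈ P.relFilt K γ 1 ∧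
    ψ x - x ∈ P.relFilt K γ 1 ∧ η x ∈ P.relFilt K γ c ∧
    φ x - ψ x - η x ∈ P.relFilt K γ (c + 1)) ?_ ?_ (fun i => ⟨X_mem_relFilt P i, hφ i, hψ i, hη i,
      by rw [h, sub_self]; exact zero_mem _⟩) α).2.2.2.2
  · simp only [map_one, sub_self, Derivation.map_one_eq_zero]
    exact ⟨one_mem_relFilt P, zero_mem _, zero_mem _, zero_mem _, zero_mem _⟩
  · rintro γ δ x y ⟨h0, h1, h2, h3, h4⟩ ⟨k0, k1, k2, k3, k4⟩
    have hx : ψ x ∈ P.relFilt K γ 0 := by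
      simpa using add_mem (relFilt_anti zero_le_one h2) h0
    have hy : φ y ∈ P.relFilt K δ 0 := by
      simpa using add_mem (relFilt_anti zero_le_one k1) k0
    simp only [map_mul, Derivation.leibniz, smul_eq_mul]
    refine ⟨mul_mem_relFilt_of_le h0 k0 (by simp), ?_, ?_, ?_, ?_⟩
    · have e : φ x * φ y - x * y = (φ x - x) * φ y + x * (φ y - y) := by ring
      rw [e]
      exact add_mem (mul_mem_relFilt_of_le h1 hy (by simp)) (mul_mem_relFilt_of_le h0 k1 (by simp))
    · have e : ψ x * ψ y - x * y = (ψ x - x) * y + ψ x * (ψ y - y) := by ring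
      rw [e]
      exact add_mem (mul_mem_relFilt_of_le h2 k0 (by simp)) (mul_mem_relFilt_of_le hx k2 (by simp))
    · rw [mul_comm y]
      exact add_mem (mul_mem_relFilt_of_le h0 k3 (by simp)) (mul_mem_relFilt_of_le h3 k0 (by simp))
    -- Each of the four products contains either a Taylor remainder of order `c + 1`, or a value of
    -- `η` (order `c`) times a deviation from the identity (order 1).
    · have e : φ x * φ y - ψ x * ψ y - (x * η y + y * η x) =
          ((φ x - ψ x - η x) * φ y + η x * (φ y - y)) +
            (ψ x * (φ y - ψ y - η y) + (ψ x - x) * η y) := by ring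
      rw [e]
      refine add_mem (add_mem ?_ ?_) (add_mem ?_ ?_)
      · exact mul_mem_relFilt_of_le h4 hy (by simp)
      · exact mul_mem_relFilt_of_le h3 k1 (by simp)
      · exact mul_mem_relFilt_of_le hx k4 (by simp)
      · exact mul_mem_relFilt_of_le h2 k3 (by omega)

/-! ### Coordinate changes near the identity and their inverses -/

/-- A coordinate change `x_i ↦ B i` that raises degrees: `v_P(B i - x_i) ≥ 1` relative to `x_i`. -/
def IsNearId (P : CPolytope n) (B : Fin n → MvPowerSeries (Fin n) K) : Prop :=
  ∀ i, B i - X i ∈ P.relFilt K (Pi.single i 1) 1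

theorem isNearId_X (P : CPolytope n) : P.IsNearId (X : Fin n → MvPowerSeries (Fin n) K) :=
  fun i => by rw [sub_self]; exact zero_mem _

theorem IsNearId.hasSubst {P : CPolytope n} {B : Fin n → MvPowerSeries (Fin n) K}
    (hB : P.IsNearId B) : HasSubst B := by
  refine hasSubst_of_constantCoeff_zero fun i => ?_
  have h : constantCoeff (B i) = coeff 0 (B i - X i) := by
    rw [map_sub, coeff_zero_X, sub_zero, coeff_zero_eq_constantCoeff]
  rw [h]
  -- A constant term would have relative degree `vdeg (-e_i) ≤ -vdeg e_i < 0`, not at least 1.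
  by_contra hne
  have h1 := hB i 0 hne
  have h2 := P.vdeg_add_le (intExp 0 - Pi.single i 1) (Pi.single i 1)
  have h3 := P.vdeg_single_pos i
  rw [sub_add_cancel, intExp_zero, vdeg_zero] at h2
  rw [intExp_zero] at h1
  omega

/-- The substitution endomorphism attached to a coordinate change near the identity. -/
noncomputable def IsNearId.hom {P : CPolytope n} {B : Fin n → MvPowerSeries (Fin n) K}
    (hB : P.IsNearId B) : MvPowerSeries (Fin n) K →ₐ[K] MvPowerSeries (Fin n) K :=
  substAlgHom hB.hasSubst

theorem IsNearId.hom_X {P : CPolytope n} {B : Fin n → MvPowerSeries (Fin n) K}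
    (hB : P.IsNearId B) (i : Fin n) : hB.hom (X i) = B i :=
  substAlgHom_X hB.hasSubst i

theorem IsNearId.mem {P : CPolytope n} {B : Fin n → MvPowerSeries (Fin n) K}
    (hB : P.IsNearId B) (i : Fin n) : B i ∈ P.relFilt K (Pi.single i 1) 0 := by
  simpa using add_mem (relFilt_anti zero_le_one (hB i)) (X_mem_relFilt P i)

theorem IsNearId.coeff_hom {P : CPolytope n} {B : Fin n → MvPowerSeries (Fin n) K}
    (hB : P.IsNearId B) (f : MvPowerSeries (Fin n) K) (β : Fin n →₀ ℕ) :
    coeff β (hB.hom f) = finsum fun α => coeff α f • coeff β (hB.hom (monomial α 1)) := by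
  simp only [IsNearId.hom, substAlgHom_monomial, map_one, one_mul]
  rw [substAlgHom_apply, coeff_subst hB.hasSubst]

theorem IsNearId.hom_sub_mem {P : CPolytope n} {A B : Fin n → MvPowerSeries (Fin n) K}
    (hA : P.IsNearId A) (hB : P.IsNearId B) {c m : ℤ}
    (h : ∀ i, A i - B i ∈ P.relFilt K (Pi.single i 1) c)
    {f : MvPowerSeries (Fin n) K} (hf : f ∈ P.relFilt K 0 m) :
    hA.hom f - hB.hom f ∈ P.relFilt K 0 (m + c) := by
  refine mem_relFilt_zero.2 fun β hβ => ?_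
  -- Coefficients of a substitution are sums over the monomials of `f`, so a nonzero coefficient of
  -- the difference comes from a single monomial, where the previous estimates apply.
  have hex : ∃ α, coeff α f ≠ 0 ∧
      coeff β (hA.hom (monomial α 1) - hB.hom (monomial α 1)) ≠ 0 := by
    by_contra! hne
    refine hβ ?_
    rw [map_sub, hA.coeff_hom, hB.coeff_hom, sub_eq_zero]
    refine finsum_congr fun α => ?_
    by_cases hα : coeff α f = 0
    · rw [hα, zero_smul, zero_smul]
    · have := hne α hα
      rw [map_sub, sub_eq_zero] at this
      rw [this]
  obtain ⟨α, hα, hne⟩ := hex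
  have h1 := mem_relFilt_zero.1 hf α hα
  have h2 := algHom_sub_monomial_mem (P := P) (φ := hA.hom) (ψ := hB.hom) (c := c)
    (fun i => by rw [hA.hom_X]; exact hA.mem i) (fun i => by rw [hB.hom_X]; exact hB.mem i)
    (fun i => by rw [hA.hom_X, hB.hom_X]; exact h i) α
  have h3 := mem_relFilt_zero.1 (mem_relFilt_zero_of_mem h2) β hne
  change P.mdeg α + c ≤ _ at h3
  omega

theorem isNearId_X_hom (P : CPolytope n) (f : MvPowerSeries (Fin n) K) :
    (P.isNearId_X (K := K)).hom f = f := by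
  rw [IsNearId.hom, substAlgHom_apply, subst_self, id]

theorem IsNearId.hom_sub_self_mem {P : CPolytope n} {B : Fin n → MvPowerSeries (Fin n) K}
    (hB : P.IsNearId B) {m : ℤ} {f : MvPowerSeries (Fin n) K} (hf : f ∈ P.relFilt K 0 m) :
    hB.hom f - f ∈ P.relFilt K 0 (m + 1) := by
  have := hB.hom_sub_mem P.isNearId_X hB hf
  rwa [isNearId_X_hom] at this

theorem IsNearId.hom_mem {P : CPolytope n} {B : Fin n → MvPowerSeries (Fin n) K}
    (hB : P.IsNearId B) {m : ℤ} {f : MvPowerSeries (Fin n) K} (hf : f ∈ P.relFilt K 0 m) :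
    hB.hom f ∈ P.relFilt K 0 m := by
  simpa using add_mem (relFilt_anti (by simp) (hB.hom_sub_self_mem hf)) hf

/-- Formal inverse function theorem for coordinate changes near the identity. -/
theorem IsNearId.bijective_hom {P : CPolytope n} {B : Fin n → MvPowerSeries (Fin n) K}
    (hB : P.IsNearId B) : Function.Bijective hB.hom := by
  constructor
  · rw [injective_iff_map_eq_zero]
    intro y hy
    refine eq_zero_of_forall_mem_relFilt (P := P) (γ := 0) fun k => ?_
    induction k with
    | zero => exact mem_relFilt_zero_of_nonpos P y le_rfl
    | succ k ih =>
      -- If `φ(y) = 0`, then `y = -(φ(y) - y)` lies one degree higher than already known.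
      have := hB.hom_sub_self_mem ih
      rw [hy, zero_sub] at this
      simpa using neg_mem this
  · intro z
    -- Neumann iteration: adding the current error to `y` raises the degree of the error by one,
    -- because `φ - id` does.
    let y : ℕ → MvPowerSeries (Fin n) K := fun k => Nat.rec 0 (fun _ y => y + (z - hB.hom y)) k
    have y_succ : ∀ k, y (k + 1) = y k + (z - hB.hom (y k)) := fun k => rfl
    have approx : ∀ k : ℕ, z - hB.hom (y k) ∈ P.relFilt K 0 k := by
      intro k
      induction k with
      | zero => exact mem_relFilt_zero_of_nonpos P _ le_rfl
      | succ k ih =>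
        have e : z - hB.hom (y (k + 1)) =
            -(hB.hom (z - hB.hom (y k)) - (z - hB.hom (y k))) := by
          rw [y_succ, map_add]; ring
        rw [e]
        exact_mod_cast neg_mem (hB.hom_sub_self_mem ih)
    obtain ⟨x, hx⟩ := exists_limit_relFilt P 0 y fun k => by
      rw [y_succ, add_sub_cancel_left]; exact approx k
    refine ⟨x, Eq.symm (sub_eq_zero.1 (eq_zero_of_forall_mem_relFilt (P := P) (γ := 0) fun k => ?_))⟩
    have e : z - hB.hom x = (z - hB.hom (y k)) - hB.hom (x - y k) := by
      rw [map_sub]; ring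
    rw [e]
    exact sub_mem (approx k) (hB.hom_mem (hx k))

/-! ### Finiteness in bounded degree, and Taylor expansion of finite sums -/

theorem le_mdeg_of_degree (P : CPolytope n) (α : Fin n →₀ ℕ) : (α.degree : ℤ) ≤ P.mdeg α := by
  induction α using Finsupp.induction_linear with
  | zero => simpa using P.mdeg_nonneg 0
  | add α β hα hβ =>
    have := P.mdeg_add_le α β
    rw [map_add]
    push_cast
    omega
  | single i k =>
    induction k with
    | zero => simpa using P.mdeg_nonneg 0
    | succ k ih =>
      have h1 := P.mdeg_add_le (Finsupp.single i k) (Finsupp.single i 1)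
      have h2 : 0 < P.mdeg (Finsupp.single i 1) := by
        change 0 < P.vdeg (intExp _)
        rw [intExp_single]
        exact P.vdeg_single_pos i
      rw [← Finsupp.single_add] at h1
      rw [Finsupp.degree_single] at ih ⊢
      push_cast
      omega

theorem finite_setOf_mdeg_le (P : CPolytope n) (m : ℤ) : {α | P.mdeg α ≤ m}.Finite := by
  refine (Finsupp.finite_of_degree_le m.toNat).subset fun α hα => ?_
  have := P.le_mdeg_of_degree α
  simp only [Set.mem_ofPred_eq] at hα ⊢
  omega

theorem eq_sum_monomial {f : MvPowerSeries (Fin n) K} {s : Finset (Fin n →₀ ℕ)}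
    (h : ∀ α, coeff α f ≠ 0 → α ∈ s) : f = ∑ α ∈ s, coeff α f • monomial α (1 : K) := by
  classical
  ext β
  simp only [map_sum, coeff_smul, coeff_monomial, mul_ite, mul_one, mul_zero,
    Finset.sum_ite_eq]
  split_ifs with hβ
  · rfl
  · by_contra hne
    exact hβ (h β hne)

/-- Finite support reduces this to monomials by linearity, without any continuity of `η`. It
suffices for the application, where `f` is an initial form. -/
theorem IsNearId.hom_sub_sub_derivation_mem {P : CPolytope n}
    {A B : Fin n → MvPowerSeries (Fin n) K} (hA : P.IsNearId A) (hB : P.IsNearId B) {c m : ℤ}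
    {η : Derivation K (MvPowerSeries (Fin n) K) (MvPowerSeries (Fin n) K)}
    (hη : ∀ i, η (X i) ∈ P.relFilt K (Pi.single i 1) c) (h : ∀ i, A i - B i = η (X i))
    {f : MvPowerSeries (Fin n) K} (hf : f ∈ P.relFilt K 0 m)
    (hfin : {α | coeff α f ≠ 0}.Finite) :
    hA.hom f - hB.hom f - η f ∈ P.relFilt K 0 (m + c + 1) := by
  have e := eq_sum_monomial (f := f) (s := hfin.toFinset) (by simp)
  rw [e]
  simp only [map_sum, map_smul, Derivation.map_smul, ← Finset.sum_sub_distrib, ← smul_sub]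
  refine sum_mem fun α hα => Submodule.smul_mem _ _ ?_
  have h1 := mem_relFilt_zero.1 hf α (by simpa using hα)
  have h2 := algHom_sub_sub_derivation_monomial_mem (P := P) (φ := hA.hom) (ψ := hB.hom)
    (fun i => by rw [hA.hom_X]; exact hA i) (fun i => by rw [hB.hom_X]; exact hB i) hη
    (fun i => by rw [hA.hom_X, hB.hom_X]; exact h i) α
  refine relFilt_anti ?_ (mem_relFilt_zero_of_mem h2)
  change _ ≤ P.mdeg α + _
  omega

/-! ### Successive approximation -/

/-- One step of the successive approximation of a solution of `f = (1 + a) · φ(g)`. -/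
theorem exists_improved_approximation {P : CPolytope n} {D m : ℤ}
    {f g h : MvPowerSeries (Fin n) K} (hm : D < m)
    (hh : h ∈ P.relFilt K 0 D) (hfin : {α | coeff α h ≠ 0}.Finite)
    (hgh : g - h ∈ P.relFilt K 0 (D + 1))
    (htj : ∀ r ∈ P.relFilt K 0 m, ∃ (b : MvPowerSeries (Fin n) K)
      (η : Derivation K (MvPowerSeries (Fin n) K) (MvPowerSeries (Fin n) K)),
      b ∈ P.relFilt K 0 (m - D) ∧ (∀ i, η (X i) ∈ P.relFilt K (Pi.single i 1) (m - D)) ∧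
      r - (b * h + η h) ∈ P.relFilt K 0 (m + 1))
    {a : MvPowerSeries (Fin n) K} (ha : a ∈ P.relFilt K 0 1)
    {A : Fin n → MvPowerSeries (Fin n) K} (hA : P.IsNearId A)
    (hE : f - (1 + a) * hA.hom g ∈ P.relFilt K 0 m) :
    ∃ (a' : MvPowerSeries (Fin n) K) (A' : Fin n → MvPowerSeries (Fin n) K)
      (hA' : P.IsNearId A'), a' ∈ P.relFilt K 0 1 ∧
      f - (1 + a') * hA'.hom g ∈ P.relFilt K 0 (m + 1) ∧
      a' - a ∈ P.relFilt K 0 (m - D) ∧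
      ∀ i, A' i - A i ∈ P.relFilt K (Pi.single i 1) (m - D) := by
  obtain ⟨b, η, hb, hη, hr⟩ := htj _ hE
  have hA' : P.IsNearId fun i => A i + η (X i) := fun i => by
    rw [add_sub_right_comm]
    exact add_mem (hA i) (relFilt_anti (by omega) (hη i))
  have hg : g ∈ P.relFilt K 0 D := by
    simpa using add_mem (relFilt_anti (by omega) hgh) hh
  refine ⟨a + b, _, hA', add_mem ha (relFilt_anti (by omega) hb), ?_, by simpa using hb,
    fun i => by simpa using hη i⟩
  -- Every summand has degree at least `m + 1`. The first is the remainder from `htj`, the third the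
  -- Taylor remainder at `h`; in the others a correction of order `m - D` acts on a series of degree
  -- `D`, and one more degree comes from `φ' - id`, from `g - h` or from `a`.
  have e : f - (1 + (a + b)) * hA'.hom g =
      (f - (1 + a) * hA.hom g - (b * h + η h)) - b * ((hA'.hom g - g) + (g - h)) -
        (hA'.hom h - hA.hom h - η h) - (hA'.hom (g - h) - hA.hom (g - h)) -
        a * (hA'.hom g - hA.hom g) := by
    rw [map_sub, map_sub]; ring
  have hd : ∀ i, (A i + η (X i)) - A i ∈ P.relFilt K (Pi.single i 1) (m - D) := fun i => by
    rw [add_sub_cancel_left]; exact hη i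
  rw [e]
  refine sub_mem (sub_mem (sub_mem (sub_mem hr ?_) ?_) ?_) ?_
  · exact mul_mem_relFilt_zero hb (add_mem (hA'.hom_sub_self_mem hg) hgh) (by omega)
  · exact relFilt_anti (by omega)
      (hA'.hom_sub_sub_derivation_mem hA hη (fun i => add_sub_cancel_left _ _) hh hfin)
  · exact relFilt_anti (by omega) (hA'.hom_sub_mem hA hd hgh)
  · exact mul_mem_relFilt_zero ha (hA'.hom_sub_mem hA hd hg) (by omega)

theorem contactEquivalent_of_hom {P : CPolytope n} {B : Fin n → MvPowerSeries (Fin n) K}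
    (hB : P.IsNearId B) {a : MvPowerSeries (Fin n) K} (ha : a ∈ P.relFilt K 0 1)
    {f g : MvPowerSeries (Fin n) K} (h : f = (1 + a) * hB.hom g) : ContactEquivalent f g := by
  have hu : IsUnit (1 + a) := by
    rw [MvPowerSeries.isUnit_iff_constantCoeff, map_add, map_one]
    have h0 : constantCoeff a = 0 := by
      rw [← coeff_zero_eq_constantCoeff_apply]
      by_contra hne
      have h1 := ha 0 hne
      rw [intExp_zero, sub_zero, vdeg_zero] at h1
      omega
    rw [h0, add_zero]
    exact isUnit_one
  obtain ⟨u, hu⟩ := hu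
  exact ⟨u, AlgEquiv.ofBijective hB.hom hB.bijective_hom, by rw [hu]; exact h⟩

theorem contactEquivalent_of_forall_approx {P : CPolytope n} {D d : ℤ} (hD : 0 ≤ D) (hd : D ≤ d)
    {f g h : MvPowerSeries (Fin n) K}
    (hh : h ∈ P.relFilt K 0 D) (hfin : {α | coeff α h ≠ 0}.Finite)
    (hgh : g - h ∈ P.relFilt K 0 (D + 1)) (hfg : f - g ∈ P.relFilt K 0 (d + 1))
    (htj : ∀ m, d < m → ∀ r ∈ P.relFilt K 0 m, ∃ (b : MvPowerSeries (Fin n) K)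
      (η : Derivation K (MvPowerSeries (Fin n) K) (MvPowerSeries (Fin n) K)),
      b ∈ P.relFilt K 0 (m - D) ∧ (∀ i, η (X i) ∈ P.relFilt K (Pi.single i 1) (m - D)) ∧
      r - (b * h + η h) ∈ P.relFilt K 0 (m + 1)) :
    ContactEquivalent f g := by
  -- Stage `k` consists of the pairs `(a, A)` whose error has degree at least `d + 1 + k`. The next
  -- correction has order `d + 1 + k - D`, hence at least `k`, which is enough for convergence.
  let S : ℕ → Type _ := fun k =>
    {q : MvPowerSeries (Fin n) K × (Fin n → MvPowerSeries (Fin n) K) //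
      q.1 ∈ P.relFilt K 0 1 ∧
      ∃ hA : P.IsNearId q.2, f - (1 + q.1) * hA.hom g ∈ P.relFilt K 0 (d + 1 + k)}
  have step : ∀ k (q : S k), ∃ q' : S (k + 1), q'.1.1 - q.1.1 ∈ P.relFilt K 0 k ∧
      ∀ i, q'.1.2 i - q.1.2 i ∈ P.relFilt K (Pi.single i 1) k := by
    rintro k ⟨⟨a, A⟩, ha, hA, hE⟩
    obtain ⟨a', A', hA', ha', hE', h1, h2⟩ := exists_improved_approximation (by omega) hh hfin hgh
      (htj (d + 1 + k) (by omega)) ha hA hE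
    exact ⟨⟨(a', A'), ha', hA', relFilt_anti (by push_cast; omega) hE'⟩,
      relFilt_anti (by omega) h1, fun i => relFilt_anti (by omega) (h2 i)⟩
  choose next next_fst next_snd using step
  let q : ∀ k, S k := fun k => Nat.rec
    ⟨(0, X), zero_mem _, P.isNearId_X, by simpa [isNearId_X_hom] using hfg⟩ next k
  obtain ⟨a, ha⟩ := exists_limit_relFilt P 0 (fun k => (q k).1.1) fun k => next_fst k (q k)
  choose A hA using fun i => exists_limit_relFilt P (Pi.single i 1) (fun k => (q k).1.2 i)
    fun k => next_snd k (q k) i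
  have ha1 : a ∈ P.relFilt K 0 1 := by
    simpa using add_mem (ha 1) (q 1).2.1
  have hA1 : P.IsNearId A := fun i => by
    obtain ⟨h1, -⟩ := (q 1).2.2
    simpa using add_mem (hA i 1) (h1 i)
  refine contactEquivalent_of_hom hA1 ha1
    (sub_eq_zero.1 (eq_zero_of_forall_mem_relFilt (P := P) (γ := 0) fun k => ?_))
  obtain ⟨hk, hE⟩ := (q k).2.2
  -- The error of the limit is compared with that at stage `k`; all three differences have degree at
  -- least `k`, for every `k`.
  have e : f - (1 + a) * hA1.hom g = (f - (1 + (q k).1.1) * hk.hom g) -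
      (a - (q k).1.1) * hA1.hom g - (1 + (q k).1.1) * (hA1.hom g - hk.hom g) := by ring
  have hg : g ∈ P.relFilt K 0 0 := mem_relFilt_zero_of_nonpos P g le_rfl
  rw [e]
  refine sub_mem (sub_mem (relFilt_anti (by omega) hE) ?_) ?_
  · exact mul_mem_relFilt_zero (ha k) (mem_relFilt_zero_of_nonpos P _ le_rfl) (by simp)
  · exact mul_mem_relFilt_zero (mem_relFilt_zero_of_nonpos P _ le_rfl)
      (hA1.hom_sub_mem hk (fun i => hA i k) hg) (by simp)

/-! ### Graded pieces and regular bases -/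

theorem mem_filt {P : CPolytope n} {d : ℕ} {f : MvPowerSeries (Fin n) K} :
    f ∈ P.filt d ↔ f ∈ P.relFilt K 0 d :=
  mem_relFilt_zero_iff_val.symm

/-- In the degrees that contain no element of a regular basis, the graded piece vanishes. -/
theorem IsRegularBasis.filt_le {P : CPolytope n} {h : MvPowerSeries (Fin n) K}
    {Λ : Set (Fin n →₀ ℕ)} (hΛ : P.IsRegularBasis h Λ) {e : ℕ}
    (he : ∀ α ∈ Λ, P.mdeg α ≠ e) : P.filt e ≤ P.tjAC h e ⊔ P.filt (e + 1) := by
  intro r hr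
  let L := DirectSum.component K ℕ (fun d => GrACPiece P h d) e
  -- The projection to degree `e` kills every basis class, as none lives in degree `e`; being also
  -- onto the piece, it forces the piece to vanish.
  have hL : L = 0 := by
    rw [← LinearMap.ker_eq_top, ← top_le_iff, ← hΛ.2, Submodule.span_le]
    rintro _ ⟨α, rfl⟩
    refine DirectSum.of_eq_of_ne _ _ _ fun h0 => he α α.2 ?_
    have := P.mdeg_nonneg (α : Fin n →₀ ℕ)
    omega
  have h1 : (Submodule.Quotient.mk ⟨r, hr⟩ : GrACPiece P h e) = 0 := by
    have h2 := LinearMap.congr_fun hL (DirectSum.lof K ℕ (fun d => GrACPiece P h d) e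
      (Submodule.Quotient.mk ⟨r, hr⟩))
    rwa [DirectSum.component.lof_self] at h2
  have h3 := (Submodule.Quotient.mk_eq_zero (Submodule.comap (Submodule.subtype (P.filt e))
    (P.tjAC h e ⊔ P.filt (e + 1)))).1 h1
  exact h3

theorem IsRegularBasis.finite {P : CPolytope n} {h : MvPowerSeries (Fin n) K}
    {Λ : Set (Fin n →₀ ℕ)} (hΛ : P.IsRegularBasis h Λ) (hh : P.AAC h) : Λ.Finite := by
  have : Module.Finite K (GrAC P h) := hh
  have : Finite Λ := hΛ.1.finite
  exact Set.toFinite Λ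

theorem tjAC_zero_le (P : CPolytope n) (e : ℕ) : P.tjAC (0 : MvPowerSeries (Fin n) K) e ≤ ⊥ := by
  rintro _ ⟨g, ξ, rfl, -⟩
  simp

/-- For `h = 0` the graded pieces are `F_e / F_{e+1}`. High powers of a variable give nonzero
classes in degrees beyond those of the finite basis. -/
theorem AAC.ne_zero {P : CPolytope n} (hn : 1 ≤ n) {h : MvPowerSeries (Fin n) K} (hh : P.AAC h)
    {Λ : Set (Fin n →₀ ℕ)} (hΛ : P.IsRegularBasis h Λ) : h ≠ 0 := by
  classical
  rintro rfl
  obtain ⟨M, hM⟩ := ((hΛ.finite hh).image P.mdeg).bddAbove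
  let α : Fin n →₀ ℕ := Finsupp.single ⟨0, hn⟩ (M.toNat + 1)
  have hα : M < P.mdeg α := by
    have := P.le_mdeg_of_degree α
    rw [Finsupp.degree_single] at this
    omega
  have h1 := hΛ.filt_le (e := (P.mdeg α).toNat) (fun β hβ => by
    have h2 : P.mdeg β ≤ M := hM ⟨β, hβ, rfl⟩
    have h3 := P.mdeg_nonneg α
    omega) (P.monomial_mem_filt α)
  have h2 := (sup_le ((P.tjAC_zero_le _).trans bot_le) le_rfl :
    P.tjAC (0 : MvPowerSeries (Fin n) K) _ ⊔ P.filt _ ≤ P.filt _) h1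
  rw [mem_filt, mem_relFilt_zero] at h2
  have h3 := h2 α (by simp)
  push_cast at h3
  have := P.mdeg_nonneg α
  omega

/-! ### Initial forms and valuations -/

theorem coeff_initialForm {P : CPolytope n} {f : MvPowerSeries (Fin n) K} {α : Fin n →₀ ℕ}
    (h : ∀ β, coeff β f ≠ 0 → P.mdeg α ≤ P.mdeg β) :
    coeff α (P.initialForm f) = coeff α f := if_pos h

theorem exists_of_coeff_initialForm_ne {P : CPolytope n} {f : MvPowerSeries (Fin n) K}
    {α : Fin n →₀ ℕ} (h : coeff α (P.initialForm f) ≠ coeff α f) :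
    coeff α (P.initialForm f) = 0 ∧ ∃ β, coeff β f ≠ 0 ∧ P.mdeg β < P.mdeg α := by
  have hne : ¬ ∀ β, coeff β f ≠ 0 → P.mdeg α ≤ P.mdeg β := fun h' => h (coeff_initialForm h')
  refine ⟨if_neg hne, ?_⟩
  push Not at hne
  exact hne

/-- A nonzero initial form is the degree `v_P(f)` part of `f`. -/
theorem exists_initialForm_degree {P : CPolytope n} {f : MvPowerSeries (Fin n) K}
    (h : P.initialForm f ≠ 0) : ∃ D : ℤ, 0 ≤ D ∧ P.val (P.initialForm f) = D ∧
      (∀ α, coeff α (P.initialForm f) ≠ 0 → P.mdeg α = D) ∧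
      f - P.initialForm f ∈ P.relFilt K 0 (D + 1) := by
  obtain ⟨α, hα⟩ := (MvPowerSeries.ne_zero_iff_exists_coeff_ne_zero _).1 h
  have same : ∀ γ, coeff γ (P.initialForm f) ≠ 0 →
      ∀ β, coeff β f ≠ 0 → P.mdeg γ ≤ P.mdeg β := by
    intro γ hγ
    by_contra hne
    exact hγ (if_neg hne)
  have cf : ∀ γ, coeff γ (P.initialForm f) ≠ 0 → coeff γ f ≠ 0 := fun γ hγ => by
    rw [← coeff_initialForm (same γ hγ)]; exact hγ
  have hD : ∀ γ, coeff γ (P.initialForm f) ≠ 0 → P.mdeg γ = P.mdeg α := fun γ hγ =>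
    le_antisymm (same γ hγ α (cf α hα)) (same α hα γ (cf γ hγ))
  refine ⟨P.mdeg α, P.mdeg_nonneg α, ?_, hD, ?_⟩
  · obtain ⟨m, hm, ⟨γ, hγ, rfl⟩, -⟩ := isLeast_minOrTop
      (S := {m | ∃ γ, coeff γ (P.initialForm f) ≠ 0 ∧ P.mdeg γ = m})
      ⟨0, by rintro _ ⟨γ, -, rfl⟩; exact P.mdeg_nonneg γ⟩ ⟨_, α, hα, rfl⟩
    rw [← hD γ hγ]
    exact hm
  · refine mem_relFilt_zero.2 fun γ hγ => ?_
    obtain ⟨-, β, hβ, hlt⟩ := exists_of_coeff_initialForm_ne (P := P) (f := f) (α := γ)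
      fun e => hγ (by rw [map_sub, e, sub_self])
    have := same α hα β hβ
    omega

theorem val_monomial (P : CPolytope n) (α : Fin n →₀ ℕ) :
    P.val (monomial α (1 : K)) = P.mdeg α := by
  classical
  have h : {m | ∃ β, coeff β (monomial α (1 : K)) ≠ 0 ∧ P.mdeg β = m} = {P.mdeg α} := by
    ext m
    simp [coeff_monomial, eq_comm]
  rw [val, h, minOrTop, if_pos (Set.singleton_nonempty _), csInf_singleton]

/-- Finiteness of `v_P(h)` allows it to be subtracted from the bounds defining `tjAC`. -/
theorem exists_of_mem_tjAC {P : CPolytope n} {h : MvPowerSeries (Fin n) K} {D : ℤ}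
    (hD : P.val h = D) {e : ℕ} {t : MvPowerSeries (Fin n) K} (ht : t ∈ P.tjAC h e) :
    ∃ (b : MvPowerSeries (Fin n) K)
      (η : Derivation K (MvPowerSeries (Fin n) K) (MvPowerSeries (Fin n) K)),
      b ∈ P.relFilt K 0 (e - D) ∧ (∀ i, η (X i) ∈ P.relFilt K (Pi.single i 1) (e - D)) ∧
      t = b * h + η h := by
  obtain ⟨b, η, rfl, hle⟩ := ht
  have key : ∀ x : WithTop ℤ, ((e : ℤ) : WithTop ℤ) ≤ x + D → ((e - D : ℤ) : WithTop ℤ) ≤ x := by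
    intro x hx
    induction x with
    | top => exact le_top
    | coe x =>
      rw [← WithTop.coe_add, WithTop.coe_le_coe] at hx
      rw [WithTop.coe_le_coe]
      omega
  rw [le_min_iff, hD] at hle
  exact ⟨b, η, mem_relFilt_zero_iff_val.2 (key _ hle.1),
    le_derVal_iff_mem_relFilt.1 (key _ hle.2), rfl⟩

end CPolytope

/-! ### The determinacy theorem -/

theorem corollary4p8 {K : Type*} [Field K] [IsAlgClosed K] {n : ℕ} (hn : 1 ≤ n)
    (P : CPolytope n) (f : MvPowerSeries (Fin n) K) (hf : f ∈ powerSeriesMaxIdeal n K)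
    (hAAC : P.AAC (P.initialForm f))
    (Λ : Set (Fin n →₀ ℕ)) (hΛ : P.IsRegularBasis (P.initialForm f) Λ) :
    ∃ d : ℕ,
      IsGreatest
        (insert (P.val (P.initialForm f))
          ((fun α => P.val (MvPowerSeries.monomial α (1 : K))) '' Λ))
        ((d : ℤ) : WithTop ℤ) ∧
      (∀ g : MvPowerSeries (Fin n) K, ((d : ℤ) : WithTop ℤ) < P.val (f - g) →
        ContactEquivalent f g) ∧
      ∀ k : ℕ, powerSeriesMaxIdeal n K ^ (k + 1) ≤ P.filt (d + 1) →
        ContactDetermined k f := by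
  obtain ⟨D, hD0, hDval, hDdeg, hfh⟩ :=
    CPolytope.exists_initialForm_degree (hAAC.ne_zero hn hΛ)
  obtain ⟨M, hM, hmax⟩ := Set.exists_max_image (insert D (P.mdeg '' Λ)) id
    (((hΛ.finite hAAC).image _).insert D) (Set.insert_nonempty _ _)
  have hM0 : 0 ≤ M := hD0.trans (hmax D (Set.mem_insert _ _))
  lift M to ℕ using hM0
  -- All valuations in the set are finite, so the maximum can be taken over a finite set of
  -- integers.
  have hset : insert (P.val (P.initialForm f))
      ((fun α => P.val (MvPowerSeries.monomial α (1 : K))) '' Λ) =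
      (fun m : ℤ => (m : WithTop ℤ)) '' (insert D (P.mdeg '' Λ)) := by
    rw [Set.image_insert_eq, hDval, Set.image_image]
    simp only [CPolytope.val_monomial]
  have equiv : ∀ g : MvPowerSeries (Fin n) K, f - g ∈ P.relFilt K 0 (M + 1) →
      ContactEquivalent f g := by
    intro g hg
    have hDM : D ≤ M := hmax D (Set.mem_insert _ _)
    refine CPolytope.contactEquivalent_of_forall_approx hD0 hDM (h := P.initialForm f)
      (CPolytope.mem_relFilt_zero.2 fun α hα => (hDdeg α hα).ge)
      ((P.finite_setOf_mdeg_le D).subset fun α hα => (hDdeg α hα).le) ?_ hg ?_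
    -- Since `M ≥ D`, the series `g` agrees with `f`, hence with the initial form of `f`, up to
    -- terms of degree at least `D + 1`.
    · have := sub_mem hfh (CPolytope.relFilt_anti (by omega) hg : f - g ∈ P.relFilt K 0 (D + 1))
      rwa [sub_sub_sub_cancel_left] at this
    · intro m hm r hr
      lift m to ℕ using by omega
      -- In degree `m > M` there is no basis monomial, so `r` splits into an element of `tjAC` and a
      -- remainder of degree at least `m + 1`.
      have h1 := hΛ.filt_le (e := m) (fun α hα => by
        have : P.mdeg α ≤ M := hmax _ (Set.mem_insert_of_mem _ ⟨α, hα, rfl⟩)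
        omega) (CPolytope.mem_filt.2 hr)
      obtain ⟨t, ht, s, hs, rfl⟩ := Submodule.mem_sup.1 h1
      obtain ⟨b, η, hb, hη, rfl⟩ := CPolytope.exists_of_mem_tjAC hDval ht
      refine ⟨b, η, hb, hη, ?_⟩
      rw [add_sub_cancel_left]
      exact_mod_cast CPolytope.mem_filt.1 hs
  refine ⟨M, ⟨?_, ?_⟩, fun g hg => equiv g ?_, fun k hk g hg => equiv g ?_⟩
  · rw [hset]
    exact ⟨_, hM, rfl⟩
  · rw [hset]
    rintro _ ⟨m, hm, rfl⟩
    exact WithTop.coe_le_coe.2 (hmax m hm)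
  · rw [CPolytope.mem_relFilt_zero_iff_val]
    generalize P.val (f - g) = x at hg
    induction x with
    | top => exact le_top
    | coe x =>
      rw [WithTop.coe_lt_coe] at hg
      exact WithTop.coe_le_coe.2 (by omega)
  · exact_mod_cast CPolytope.mem_filt.1 (hk hg)
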